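/- Let $K$ be a field, let $L$ be a finite-dimensional Lie algebra over $K$, and let $U(L)$ be its universal enveloping algebra. Suppose that either $\operatorname{char} K \neq 2$ and $L \neq 0$, or $\operatorname{char} K = 2$ and $L$ is not commutative (that is, $[x,y] \neq 0$ for some $x, y \in L$). View $U(L)$ as an abelian Lie algebra (with zero bracket), let $L$ act on it by left multiplication, and form the semidirect product $U(L) \rtimes L$, that is, the vector space $U(L) \oplus L$ with the Lie bracket $[(u,x),(v,y)] = (xv - yu, [x,y])$. Then the Lie algebra $U(L) \rtimes L$ is finitely generated but not finitely presented. Here a Lie algebra $A$ over $K$ is called finitely presented if there exist a free Lie algebra $F$ over $K$ on finitely many generators and a surjective Lie algebra homomorphism $\pi \colon F \to A$ such that $\ker \pi$ is finitely generated as a Lie ideal of $F$. -/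

import Mathlib

/-- A Lie algebra is finitely generated if it is generated, as a Lie algebra, by a finite set. -/
def LieAlgebra.IsFinGenerated (K A : Type*) [CommRing K] [LieRing A] [LieAlgebra K A] : Prop :=
  ∃ s : Finset A, LieSubalgebra.lieSpan K A (s : Set A) = ⊤

/-- A Lie algebra `A` is finitely presented if there is an epimorphism `π : F → A` from a finitely
generated free Lie algebra `F` whose kernel is generated, as a Lie ideal of `F`, by a finite set. -/
def LieAlgebra.IsFinPresented (K A : Type*) [CommRing K] [LieRing A] [LieAlgebra K A] : Prop :=
  ∃ (n : ℕ) (π : FreeLieAlgebra K (Fin n) →ₗ⁅K⁆ A), Function.Surjective π ∧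
    ∃ s : Finset (FreeLieAlgebra K (Fin n)),
      LieSubmodule.lieSpan K (FreeLieAlgebra K (Fin n))
        (s : Set (FreeLieAlgebra K (Fin n))) = π.ker

/-- The vector space underlying the universal enveloping algebra `U(L)`; this copy of it carries
the zero Lie bracket. -/
def AbelianEnveloping (K L : Type*) [CommRing K] [LieRing L] [LieAlgebra K L] :=
  UniversalEnvelopingAlgebra K L

namespace AbelianEnveloping

variable (K L : Type*) [CommRing K] [LieRing L] [LieAlgebra K L]

instance : AddCommGroup (AbelianEnveloping K L) :=
  inferInstanceAs (AddCommGroup (UniversalEnvelopingAlgebra K L))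

instance : Module K (AbelianEnveloping K L) :=
  inferInstanceAs (Module K (UniversalEnvelopingAlgebra K L))

/-- The identity map `U(L) → U(L)`, onto the copy with zero Lie bracket. -/
def of : UniversalEnvelopingAlgebra K L ≃ₗ[K] AbelianEnveloping K L :=
  LinearEquiv.refl K (UniversalEnvelopingAlgebra K L)

instance : LieRing (AbelianEnveloping K L) where
  bracket _ _ := 0
  add_lie _ _ _ := (add_zero 0).symm
  lie_add _ _ _ := (add_zero 0).symm
  lie_self _ := rfl
  leibniz_lie _ _ _ := (add_zero 0).symm

instance : LieAlgebra K (AbelianEnveloping K L) where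
  lie_smul t _ _ := (smul_zero t).symm

theorem lie_eq_zero (u v : AbelianEnveloping K L) : ⁅u, v⁆ = 0 := rfl

/-- The action of `L` on the abelian Lie algebra `U(L)` by left multiplication; every linear
endomorphism of an abelian Lie algebra is a derivation. -/
noncomputable def leftMul :
    L →ₗ⁅K⁆ LieDerivation K (AbelianEnveloping K L) (AbelianEnveloping K L) where
  toFun x :=
    { toLinearMap := (of K L).toLinearMap ∘ₗ
        LinearMap.mulLeft K (UniversalEnvelopingAlgebra.ι K x) ∘ₗ (of K L).symm.toLinearMap
      leibniz' := fun u v => by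
        simp only [lie_eq_zero, map_zero, sub_zero] }
  map_add' x y := by
    ext u
    change of K L (UniversalEnvelopingAlgebra.ι K (x + y) * (of K L).symm u) =
      of K L (UniversalEnvelopingAlgebra.ι K x * (of K L).symm u) +
        of K L (UniversalEnvelopingAlgebra.ι K y * (of K L).symm u)
    rw [map_add, add_mul, map_add]
  map_smul' t x := by
    ext u
    change of K L (UniversalEnvelopingAlgebra.ι K (t • x) * (of K L).symm u) =
      t • of K L (UniversalEnvelopingAlgebra.ι K x * (of K L).symm u)
    rw [map_smul, smul_mul_assoc, map_smul]
  map_lie' := by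
    intro x y
    let _ : LieRing (UniversalEnvelopingAlgebra K L) := LieRing.ofAssociativeRing
    ext u
    rw [LieDerivation.commutator_apply]
    change of K L (UniversalEnvelopingAlgebra.ι K ⁅x, y⁆ * (of K L).symm u) =
      of K L (UniversalEnvelopingAlgebra.ι K x *
        (UniversalEnvelopingAlgebra.ι K y * (of K L).symm u)) -
      of K L (UniversalEnvelopingAlgebra.ι K y *
        (UniversalEnvelopingAlgebra.ι K x * (of K L).symm u))
    rw [← map_sub, ← mul_assoc, ← mul_assoc, ← sub_mul, LieHom.map_lie,
      LieRing.of_associative_ring_bracket]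

theorem leftMul_apply (x : L) (u : UniversalEnvelopingAlgebra K L) :
    leftMul K L x (of K L u) = of K L (UniversalEnvelopingAlgebra.ι K x * u) := rfl

end AbelianEnveloping

/-- The semidirect product `U(L) ⋊ L`, where `U(L)` is viewed as an abelian Lie algebra and `L` acts
on it by left multiplication. -/
abbrev EnvelopingSemidirect (K L : Type*) [CommRing K] [LieRing L] [LieAlgebra K L] :=
  LieAlgebra.SemiDirectSum (AbelianEnveloping K L) L (AbelianEnveloping.leftMul K L)

/-! A 2-cocycle on a finitely presented algebra takes commuting pairs into a finite-dimensional
space: lift the presentation to the central extension; relators then have central lifts, so only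
finitely many matter. In `U(L) ⋊ L` all of `U(L)` commutes, and every `L`-invariant alternating form
on `U(L)` gives a cocycle. It remains to find such a form whose values span an infinite-dimensional
space. If some `⁅x, y⁆` is not central, use `S(u) v - S(v) u`, with `S` the antipode. Its values
include `-x ^ k ⁅x, y⁆ x ^ k`; a representation of `U(L)` on polynomials in `T` shows that they have
unbounded degree, with no need of the PBW theorem. If a nonzero functional kills all brackets, map
`U(L)` to `K[X]` and take the odd coefficients of `p(-X) q(X)`. One of the two cases always occurs.
-/

/-- Values of a `2`-cocycle with trivial coefficients on commuting pairs of elements of a finitely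
presented Lie algebra span a finite-dimensional space. -/
theorem LieAlgebra.IsFinPresented.exists_finset_twoCocycle_mem_span {K A W : Type*} [CommRing K]
    [LieRing A] [LieAlgebra K A] [AddCommGroup W] [Module K W] [LieRingModule A W] [LieModule K A W]
    [LieModule.IsTrivial A W] (hA : LieAlgebra.IsFinPresented K A)
    (c : LieModule.Cohomology.twoCocycle K A W) :
    ∃ t : Finset W, ∀ a b : A, ⁅a, b⁆ = 0 →
      (c : LieModule.Cohomology.twoCochain K A W) a b ∈ Submodule.span K (t : Set W) := by
  classical
  obtain ⟨n, π, hπ, s, hs⟩ := hA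
  let E := LieAlgebra.ofTwoCocycle c
  let e : A × W ≃ E := LieAlgebra.ofProd c
  let p : E →ₗ⁅K⁆ A :=
    { toFun := fun x => (e.symm x).1
      map_add' := fun _ _ => rfl
      map_smul' := fun _ _ => rfl
      map_lie' := rfl }
  have hlie : ∀ x y : E, (e.symm ⁅x, y⁆).2 =
      (c : LieModule.Cohomology.twoCochain K A W) (e.symm x).1 (e.symm y).1 := by
    intro x y
    change _ + ⁅(e.symm x).1, (e.symm y).2⁆ - ⁅(e.symm y).1, (e.symm x).2⁆ = _
    rw [trivial_lie_zero, trivial_lie_zero, add_zero, sub_zero]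
    rfl
  -- The lift of `π` to the extension; the choice of `W`-components on generators is immaterial.
  let ψ : FreeLieAlgebra K (Fin n) →ₗ⁅K⁆ E :=
    FreeLieAlgebra.lift K fun i => e (π (FreeLieAlgebra.of K i), 0)
  have hψ : ∀ f, (e.symm (ψ f)).1 = π f := by
    have : p.comp ψ = π := by
      apply FreeLieAlgebra.hom_ext
      intro i
      simp only [LieHom.comp_apply, ψ, FreeLieAlgebra.lift_of_apply]
      rfl
    exact fun f => LieHom.congr_fun this f
  refine ⟨s.image fun f => (e.symm (ψ f)).2, fun a b hab => ?_⟩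
  have key : ∀ f ∈ LieSubmodule.lieSpan K (FreeLieAlgebra K (Fin n))
      (s : Set (FreeLieAlgebra K (Fin n))), (e.symm (ψ f)).2 ∈
        Submodule.span K ((s.image fun f => (e.symm (ψ f)).2 : Finset W) : Set W) := by
    intro f hf
    induction hf using LieSubmodule.lieSpan_induction with
    | mem x hx => exact Submodule.subset_span (Finset.mem_image_of_mem _ hx)
    | zero => rw [map_zero]; exact Submodule.zero_mem _
    | add x y _ _ hx hy => rw [map_add]; exact Submodule.add_mem _ hx hy
    | smul r x _ hx => rw [map_smul]; exact Submodule.smul_mem _ _ hx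
    -- `ψ y` lies over `0`, hence is central: brackets with it add nothing to the span.
    | lie x y hy _ =>
      rw [hs, LieHom.mem_ker] at hy
      rw [LieHom.map_lie, hlie, hψ y, hy, map_zero]
      exact Submodule.zero_mem _
  obtain ⟨f, rfl⟩ := hπ a
  obtain ⟨g, rfl⟩ := hπ b
  have hfg := key ⁅f, g⁆ (by rw [hs, LieHom.mem_ker, LieHom.map_lie, hab])
  rwa [LieHom.map_lie, hlie, hψ, hψ] at hfg

/-! ### Finite generation, and cocycles from invariant forms -/

namespace EnvelopingSemidirect

variable {K L : Type*} [CommRing K] [LieRing L] [LieAlgebra K L]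

local notation "𝓤" => UniversalEnvelopingAlgebra K L

attribute [local instance 100] LieRing.ofAssociativeRing

/-- By the universal property, the identity of `U(L)` factors through `S`. -/
theorem eq_top_of_range_ι_le {S : Subalgebra K 𝓤}
    (hS : ∀ x : L, UniversalEnvelopingAlgebra.ι K x ∈ S) : S = ⊤ := by
  let g : L →ₗ⁅K⁆ S :=
    { toFun := fun x => ⟨UniversalEnvelopingAlgebra.ι K x, hS x⟩
      map_add' := fun x y => Subtype.ext (map_add _ x y)
      map_smul' := fun t x => Subtype.ext (map_smul _ t x)
      map_lie' := fun {x y} => Subtype.ext (LieHom.map_lie _ x y) }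
  have h : S.val.comp (UniversalEnvelopingAlgebra.lift K g) = AlgHom.id K 𝓤 := by
    apply UniversalEnvelopingAlgebra.hom_ext
    ext x
    exact congrArg S.val (UniversalEnvelopingAlgebra.lift_ι_apply K g x)
  refine eq_top_iff.2 fun u _ => ?_
  rw [← AlgHom.id_apply (R := K) u, ← h]
  exact (UniversalEnvelopingAlgebra.lift K g u).2

/-- The elements that multiply `M` into itself from the left form a subalgebra containing `L`. -/
theorem mem_of_one_mem_of_ι_mul_mem (M : Submodule K 𝓤) (h1 : 1 ∈ M)
    (hM : ∀ (x : L), ∀ u ∈ M, UniversalEnvelopingAlgebra.ι K x * u ∈ M) (u : 𝓤) : u ∈ M := by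
  let S : Subalgebra K 𝓤 :=
    { carrier := {a | ∀ v ∈ M, a * v ∈ M}
      mul_mem' := fun {a b} ha hb v hv => by rw [mul_assoc]; exact ha _ (hb _ hv)
      add_mem' := fun {a b} ha hb v hv => by rw [add_mul]; exact M.add_mem (ha _ hv) (hb _ hv)
      algebraMap_mem' := fun r v hv => by
        rw [← Algebra.smul_def]; exact M.smul_mem _ hv }
  have hS : u ∈ S := by
    rw [eq_top_of_range_ι_le (S := S) hM]
    trivial
  simpa using hS 1 h1

theorem lie_inr_inl (x : L) (u : 𝓤) :
    (⁅(⟨0, x⟩ : EnvelopingSemidirect K L), ⟨AbelianEnveloping.of K L u, 0⟩⁆ :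
      EnvelopingSemidirect K L) =
      ⟨AbelianEnveloping.of K L (UniversalEnvelopingAlgebra.ι K x * u), 0⟩ := by
  rw [LieAlgebra.SemiDirectSum.lie_eq_mk]
  simp [AbelianEnveloping.leftMul_apply]

theorem isFinGenerated [Module.Finite K L] :
    LieAlgebra.IsFinGenerated K (EnvelopingSemidirect K L) := by
  classical
  obtain ⟨b, hb⟩ := Module.Finite.fg_top (R := K) (M := L)
  let i := LieAlgebra.SemiDirectSum.inr (AbelianEnveloping.leftMul K L)
  let j := LieAlgebra.SemiDirectSum.inl (AbelianEnveloping.leftMul K L)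
  refine ⟨insert (j (AbelianEnveloping.of K L 1)) (b.image i), ?_⟩
  set N := LieSubalgebra.lieSpan K (EnvelopingSemidirect K L)
    ((insert (j (AbelianEnveloping.of K L 1)) (b.image i) : Finset _) : Set _) with hN
  have hi : ∀ x : L, i x ∈ N := by
    have : Submodule.span K (b : Set L) ≤ N.toSubmodule.comap (i : L →ₗ[K] _) :=
      Submodule.span_le.2 fun x hx => LieSubalgebra.subset_lieSpan <| by
        simpa using Or.inr ⟨x, hx, rfl⟩
    rw [hb] at this
    exact fun x => this (Submodule.mem_top (x := x))
  have hj : ∀ u : 𝓤, j (AbelianEnveloping.of K L u) ∈ N := by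
    refine mem_of_one_mem_of_ι_mul_mem
      (N.toSubmodule.comap ((j : _ →ₗ[K] _) ∘ₗ (AbelianEnveloping.of K L).toLinearMap)) ?_ ?_
    · exact LieSubalgebra.subset_lieSpan (by simp)
    · intro x u hu
      have := N.lie_mem (hi x) hu
      change j (AbelianEnveloping.of K L (UniversalEnvelopingAlgebra.ι K x * u)) ∈ N
      change ⁅i x, j (AbelianEnveloping.of K L u)⁆ ∈ N at this
      rwa [show ⁅i x, j (AbelianEnveloping.of K L u)⁆ = _ from lie_inr_inl x u] at this
  refine eq_top_iff.2 fun a _ => ?_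
  have : a = j a.left + i a.right := by
    simp [i, j]
  rw [this]
  exact N.add_mem (hj a.left) (hi a.right)

/-- An `L`-invariant alternating form on `U(L)` extends to a `2`-cocycle of `U(L) ⋊ L` with trivial
coefficients, so that finite presentability bounds the space of its values. -/
theorem exists_finset_mem_span_of_isFinPresented
    (h : LieAlgebra.IsFinPresented K (EnvelopingSemidirect K L)) {W : Type*} [AddCommGroup W]
    [Module K W] (B : 𝓤 →ₗ[K] 𝓤 →ₗ[K] W) (halt : ∀ u, B u u = 0)
    (hinv : ∀ (x : L) (u v : 𝓤), B (UniversalEnvelopingAlgebra.ι K x * u) v +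
      B u (UniversalEnvelopingAlgebra.ι K x * v) = 0) :
    ∃ t : Finset W, ∀ u v, B u v ∈ Submodule.span K (t : Set W) := by
  let : LieRingModule (EnvelopingSemidirect K L) W :=
    { bracket := fun _ _ => 0
      add_lie := fun _ _ _ => (add_zero 0).symm
      lie_add := fun _ _ _ => (add_zero 0).symm
      leibniz_lie := fun _ _ _ => (add_zero 0).symm }
  have : LieModule.IsTrivial (EnvelopingSemidirect K L) W := ⟨fun _ _ => rfl⟩
  have : LieModule K (EnvelopingSemidirect K L) W :=
    { smul_lie := fun t _ _ => (smul_zero t).symm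
      lie_smul := fun t _ _ => (smul_zero t).symm }
  let q : EnvelopingSemidirect K L →ₗ[K] 𝓤 :=
    (AbelianEnveloping.of K L).symm.toLinearMap ∘ₗ LieAlgebra.SemiDirectSum.projl _
  have hq : ∀ a b : EnvelopingSemidirect K L, q ⁅a, b⁆ =
      UniversalEnvelopingAlgebra.ι K a.right * q b -
        UniversalEnvelopingAlgebra.ι K b.right * q a := by
    intro a b
    change (0 : 𝓤) + UniversalEnvelopingAlgebra.ι K a.right * q b -
        UniversalEnvelopingAlgebra.ι K b.right * q a = _
    rw [zero_add]
  let c₀ : LieModule.Cohomology.twoCochain K (EnvelopingSemidirect K L) W :=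
    ⟨B.compl₁₂ q q, fun a => halt (q a)⟩
  have hskew : ∀ u v, B u v = - B v u := fun u v => by
    rw [eq_neg_iff_add_eq_zero]
    simpa [halt] using halt (u + v)
  -- The six terms of the cocycle identity cancel in pairs, one invariance relation for each
  -- argument.
  have hc₀ : c₀ ∈ LieModule.Cohomology.twoCocycle K (EnvelopingSemidirect K L) W := by
    rw [LieModule.Cohomology.mem_twoCocycle_iff_of_trivial]
    intro a b d
    change B (q a) (q ⁅b, d⁆) = B (q ⁅a, b⁆) (q d) + B (q b) (q ⁅a, d⁆)
    simp only [hq, map_sub, LinearMap.sub_apply]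
    have h1 := hinv a.right (q b) (q d)
    have h2 := hinv b.right (q a) (q d)
    have h3 := hinv d.right (q a) (q b)
    rw [hskew (q b) (UniversalEnvelopingAlgebra.ι K d.right * q a)]
    rw [add_eq_zero_iff_eq_neg] at h1 h2 h3
    rw [h1, h2, h3]
    abel
  obtain ⟨t, ht⟩ := h.exists_finset_twoCocycle_mem_span ⟨c₀, hc₀⟩
  refine ⟨t, fun u v => ht ⟨AbelianEnveloping.of K L u, 0⟩ ⟨AbelianEnveloping.of K L v, 0⟩ ?_⟩
  rw [LieAlgebra.SemiDirectSum.lie_eq_mk]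
  simp [AbelianEnveloping.lie_eq_zero]

end EnvelopingSemidirect

/-! ### Polynomials in `T` as finitely supported sequences -/

namespace Finsupp

variable {K A : Type*} [CommRing K] [AddCommGroup A] [Module K A]

theorem exists_forall_mem_span_eq_zero (t : Finset (ℕ →₀ A)) :
    ∃ N, ∀ p ∈ Submodule.span K (t : Set (ℕ →₀ A)), ∀ n, N ≤ n → p n = 0 := by
  classical
  refine ⟨(t.biUnion Finsupp.support).sup Nat.succ, fun p hp n hn => ?_⟩
  have hle : Submodule.span K (t : Set (ℕ →₀ A)) ≤ LinearMap.ker (Finsupp.lapply n) := by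
    refine Submodule.span_le.2 fun q hq => ?_
    by_contra hne
    have := Finset.le_sup (f := Nat.succ)
      (Finset.mem_biUnion.2 ⟨q, hq, Finsupp.mem_support_iff.2 hne⟩)
    exact absurd (this.trans hn) (Nat.not_succ_le_self n)
  exact hle hp

/-- `p` has no coefficient beyond `m`, and `a` is the one at `m`. -/
def IsTopCoeff (m : ℕ) (a : A) (p : ℕ →₀ A) : Prop := p m = a ∧ ∀ n, m < n → p n = 0

theorem IsTopCoeff.neg {m : ℕ} {a : A} {p : ℕ →₀ A} (h : IsTopCoeff m a p) :
    IsTopCoeff m (-a) (-p) :=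
  ⟨by simp [h.1], fun n hn => by simp [h.2 n hn]⟩

end Finsupp

attribute [local instance 100] LieRing.ofAssociativeRing

/-! ### A representation that raises the degree in `T` -/

section TwistedDerivation

variable {K L A : Type*} [CommRing K] [LieRing L] [LieAlgebra K L] [CommRing A] [Algebra K A]

/-- The operator `d + T * c` on polynomials in `T` over `A`. -/
noncomputable def coeffMapAddShift (d : A →ₗ[K] A) (c : A) : Module.End K (ℕ →₀ A) :=
  Finsupp.mapRange.linearMap d +
    Finsupp.lmapDomain A K Nat.succ ∘ₗ Finsupp.mapRange.linearMap (LinearMap.mulLeft K c)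

theorem coeffMapAddShift_apply_zero (d : A →ₗ[K] A) (c : A) (p : ℕ →₀ A) :
    coeffMapAddShift d c p 0 = d (p 0) := by
  simp [coeffMapAddShift, Finsupp.mapDomain_of_notMem_range]

theorem coeffMapAddShift_apply_succ (d : A →ₗ[K] A) (c : A) (p : ℕ →₀ A) (n : ℕ) :
    coeffMapAddShift d c p (n + 1) = d (p (n + 1)) + c * p n := by
  simp [coeffMapAddShift, Finsupp.mapDomain_apply Nat.succ_injective]

/-- The action `x ↦ D x + T * D x ℓ` of `L` on polynomials in `T` over `A`, for an action `D` of
`L` on `A` by derivations and an element `ℓ` of `A`. -/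
noncomputable def twistedDerivation (D : L →ₗ⁅K⁆ Derivation K A A) (ℓ : A) :
    L →ₗ⁅K⁆ Module.End K (ℕ →₀ A) where
  toFun x := coeffMapAddShift (D x : A →ₗ[K] A) (D x ℓ)
  map_add' x y := by
    refine LinearMap.ext fun p => Finsupp.ext fun n => ?_
    cases n
    · simp [coeffMapAddShift_apply_zero]
    · simp [coeffMapAddShift_apply_succ]
      ring
  map_smul' t x := by
    refine LinearMap.ext fun p => Finsupp.ext fun n => ?_
    cases n
    · simp [coeffMapAddShift_apply_zero]
    · simp [coeffMapAddShift_apply_succ]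
  -- Formally the operator is `D x` conjugated by `exp (T ℓ)`. The `T ^ 2` terms of the commutator
  -- cancel since `A` is commutative.
  map_lie' := by
    intro x y
    refine LinearMap.ext fun p => Finsupp.ext fun n => ?_
    rcases n with _ | _ | n <;>
    · simp [LieRing.of_associative_ring_bracket, coeffMapAddShift_apply_zero,
        coeffMapAddShift_apply_succ, Derivation.commutator_apply]
      try ring

theorem twistedDerivation_apply_succ (D : L →ₗ⁅K⁆ Derivation K A A) (ℓ : A) (x : L) (p : ℕ →₀ A)
    (n : ℕ) :
    twistedDerivation D ℓ x p (n + 1) = D x (p (n + 1)) + D x ℓ * p n :=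
  coeffMapAddShift_apply_succ _ _ _ _

variable (D : L →ₗ⁅K⁆ Derivation K A A) (ℓ : A)

local notation "φ" => UniversalEnvelopingAlgebra.lift K (twistedDerivation D ℓ)
local notation "ι" => UniversalEnvelopingAlgebra.ι K

theorem Finsupp.IsTopCoeff.lift_twistedDerivation {m : ℕ} {a : A} {p : ℕ →₀ A}
    (h : Finsupp.IsTopCoeff m a p) (x : L) :
    Finsupp.IsTopCoeff (m + 1) (D x ℓ * a) (φ (ι x) p) := by
  rw [UniversalEnvelopingAlgebra.lift_ι_apply]
  refine ⟨by simp [twistedDerivation_apply_succ, h.1, h.2], fun n hn => ?_⟩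
  obtain ⟨n, rfl⟩ := Nat.exists_eq_add_one_of_ne_zero (Nat.ne_zero_of_lt hn)
  rw [twistedDerivation_apply_succ, h.2 _ (by omega), h.2 _ (by omega), map_zero, mul_zero,
    add_zero]

theorem Finsupp.IsTopCoeff.lift_twistedDerivation_pow {m : ℕ} {a : A} {p : ℕ →₀ A}
    (h : Finsupp.IsTopCoeff m a p) (x : L) (k : ℕ) :
    Finsupp.IsTopCoeff (m + k) (D x ℓ ^ k * a) (φ (ι x ^ k) p) := by
  induction k with
  | zero => simpa using h
  | succ k ih =>
    rw [pow_succ' (ι x), pow_succ' (D x ℓ), map_mul, mul_assoc]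
    exact ih.lift_twistedDerivation D ℓ x

end TwistedDerivation

/-! ### The adjoint action on the symmetric algebra -/

section AdjointDerivation

variable {K L I : Type*} [CommRing K] [LieRing L] [LieAlgebra K L] (b : Module.Basis I K L)

/-- The inclusion of `L` into polynomials in the elements of a basis of `L`. -/
noncomputable def linearForm : L →ₗ[K] MvPolynomial I K := b.constr K MvPolynomial.X

theorem linearForm_basis (i : I) : linearForm b (b i) = MvPolynomial.X i :=
  b.constr_basis K _ i

theorem linearForm_injective : Function.Injective (linearForm b) := by
  intro x y h
  have hX : LinearIndependent K (MvPolynomial.X : I → MvPolynomial I K) :=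
    MvPolynomial.linearIndependent_X I K
  simp only [linearForm, Module.Basis.constr_def, LinearMap.comp_apply] at h
  simp only [Finsupp.lmapDomain_apply, LinearEquiv.coe_coe,
    Finsupp.linearCombination_mapDomain] at h
  exact b.repr.injective (hX h)

theorem mkDerivation_linearForm_lie (x v : L) :
    MvPolynomial.mkDerivation K (fun i => linearForm b ⁅x, b i⁆) (linearForm b v) =
      linearForm b ⁅x, v⁆ := by
  have : ((MvPolynomial.mkDerivation K fun i => linearForm b ⁅x, b i⁆ :
      Derivation K (MvPolynomial I K) (MvPolynomial I K)) :
      MvPolynomial I K →ₗ[K] MvPolynomial I K) ∘ₗ linearForm b =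
      linearForm b ∘ₗ (LieAlgebra.ad K L x : L →ₗ[K] L) := by
    refine b.ext fun i => ?_
    simp [linearForm_basis, MvPolynomial.mkDerivation_X]
  exact LinearMap.congr_fun this v

/-- The adjoint action of `L`, extended to polynomials in a basis of `L`. -/
noncomputable def adjointDerivation :
    L →ₗ⁅K⁆ Derivation K (MvPolynomial I K) (MvPolynomial I K) where
  toFun x := MvPolynomial.mkDerivation K fun i => linearForm b ⁅x, b i⁆
  map_add' x y := MvPolynomial.derivation_ext fun i => by
    simp [MvPolynomial.mkDerivation_X]
  map_smul' t x := MvPolynomial.derivation_ext fun i => by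
    simp [MvPolynomial.mkDerivation_X]
  map_lie' := by
    intro x y
    refine MvPolynomial.derivation_ext fun i => ?_
    rw [Derivation.commutator_apply]
    simp only [MvPolynomial.mkDerivation_X, mkDerivation_linearForm_lie]
    rw [lie_lie, map_sub]

theorem adjointDerivation_linearForm (x v : L) :
    adjointDerivation b x (linearForm b v) = linearForm b ⁅x, v⁆ :=
  mkDerivation_linearForm_lie b x v

end AdjointDerivation

/-! ### The invariant form given by the antipode -/

namespace UniversalEnvelopingAlgebra

variable (K L : Type*) [CommRing K] [LieRing L] [LieAlgebra K L]

local notation "𝓤" => UniversalEnvelopingAlgebra K L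

/-- The principal anti-automorphism of `U(L)`, with `x ↦ -x` for `x` in `L`. -/
noncomputable def antipode : 𝓤 →ₐ[K] 𝓤ᵐᵒᵖ :=
  lift K
    { toFun := fun x => MulOpposite.op (-ι K x)
      map_add' := fun x y => by rw [map_add, neg_add, MulOpposite.op_add]
      map_smul' := fun t x => by rw [map_smul, ← smul_neg, MulOpposite.op_smul, RingHom.id_apply]
      map_lie' := fun {x y} => by
        rw [LieHom.map_lie, LieRing.of_associative_ring_bracket,
          LieRing.of_associative_ring_bracket, ← MulOpposite.op_mul, ← MulOpposite.op_mul,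
          neg_mul_neg, neg_mul_neg, neg_sub, MulOpposite.op_sub] }

variable {K L}

theorem antipode_ι (x : L) : antipode K L (ι K x) = MulOpposite.op (-ι K x) :=
  lift_ι_apply K _ x

variable (K L)

/-- The form `(u, v) ↦ S(u) v - S(v) u` on `U(L)`, with `S` the antipode. -/
noncomputable def antipodeForm : 𝓤 →ₗ[K] 𝓤 →ₗ[K] 𝓤 :=
  let m : 𝓤 →ₗ[K] 𝓤 →ₗ[K] 𝓤 := LinearMap.mul K 𝓤 ∘ₗ
    (MulOpposite.opLinearEquiv K).symm.toLinearMap ∘ₗ (antipode K L).toLinearMap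
  m - m.flip

variable {K L}

theorem antipodeForm_apply (u v : 𝓤) :
    antipodeForm K L u v = (antipode K L u).unop * v - (antipode K L v).unop * u := rfl

theorem antipodeForm_self (u : 𝓤) : antipodeForm K L u u = 0 := sub_self _

theorem antipodeForm_ι_mul (x : L) (u v : 𝓤) :
    antipodeForm K L (ι K x * u) v + antipodeForm K L u (ι K x * v) = 0 := by
  simp only [antipodeForm_apply, map_mul, antipode_ι, MulOpposite.unop_mul, MulOpposite.unop_op]
  noncomm_ring

/-- The word has even length `2k + 2`, so the antipode reverses it without a sign, and the
difference contracts to a commutator in the middle. -/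
theorem antipodeForm_one_mul (x y : L) (k : ℕ) :
    antipodeForm K L 1 (ι K x ^ k * ι K y * ι K x ^ (k + 1)) =
      -(ι K x ^ k * ι K ⁅x, y⁆ * ι K x ^ k) := by
  simp only [antipodeForm_apply, map_mul, map_pow, antipode_ι, map_one, MulOpposite.unop_mul,
    MulOpposite.unop_pow, MulOpposite.unop_op, MulOpposite.unop_one, one_mul, mul_one,
    LieHom.map_lie, LieRing.of_associative_ring_bracket]
  have h : ((-ι K x) ^ (k + 1) * (-ι K y * (-ι K x) ^ k) : 𝓤) =
      ι K x ^ (k + 1) * ι K y * ι K x ^ k := by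
    rcases Nat.even_or_odd k with hk | hk
    · rw [hk.neg_pow, hk.add_one.neg_pow]
      noncomm_ring
    · rw [hk.neg_pow, hk.add_one.neg_pow]
      noncomm_ring
  rw [h, show ι K x ^ (k + 1) * ι K y * ι K x ^ k = ι K x ^ k * ι K x * ι K y * ι K x ^ k by
    rw [pow_succ], pow_succ' (ι K x) k]
  noncomm_ring

end UniversalEnvelopingAlgebra

/-- A group is not the union of two proper subgroups, here the two centralizers. -/
theorem exists_lie_ne_zero_and_lie_ne_zero {L : Type*} [LieRing L] {x z : L}
    (hx : ∃ y : L, ⁅x, y⁆ ≠ 0) (hz : ∃ y : L, ⁅z, y⁆ ≠ 0) :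
    ∃ y : L, ⁅x, y⁆ ≠ 0 ∧ ⁅z, y⁆ ≠ 0 := by
  obtain ⟨a, ha⟩ := hx
  obtain ⟨b, hb⟩ := hz
  by_cases hza : ⁅z, a⁆ = 0
  · by_cases hxb : ⁅x, b⁆ = 0
    · exact ⟨a + b, by simpa [hxb] using ha, by simpa [hza] using hb⟩
    · exact ⟨b, hxb, hb⟩
  · exact ⟨a, ha, hza⟩

/-! ### Odd coefficients of `f(-X) f(X)` -/

namespace Polynomial

variable {K : Type*} [CommRing K]

/-- For `i + j` odd, the terms at `(i, j)` and `(j, i)` have opposite signs and `i ≠ j`; no division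
by 2 occurs. -/
theorem coeff_aeval_neg_X_mul_self_of_odd (f : K[X]) {n : ℕ} (hn : Odd n) :
    (aeval (C (-1) * X) f * f).coeff n = 0 := by
  rw [coeff_mul]
  refine Finset.sum_involution (fun p _ => p.swap) ?_ ?_ ?_ ?_
  · rintro ⟨i, j⟩ hij
    rw [Finset.HasAntidiagonal.mem_antidiagonal] at hij
    simp only [Prod.swap, ← comp_eq_aeval, comp_C_mul_X_coeff]
    subst hij
    rcases Nat.even_or_odd i with hi | hi
    · rw [hi.neg_one_pow, ((Nat.odd_add'.1 hn).2 hi).neg_one_pow]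
      ring
    · rw [hi.neg_one_pow, ((Nat.odd_add.1 hn).1 hi).neg_one_pow]
      ring
  · rintro ⟨i, j⟩ hij _ h
    rw [Finset.HasAntidiagonal.mem_antidiagonal] at hij
    simp only [Prod.swap, Prod.mk.injEq] at h
    subst hij
    rw [h.1] at hn
    exact Nat.not_even_iff_odd.2 hn ⟨i, rfl⟩
  · intro p hp
    exact Finset.HasAntidiagonal.swap_mem_antidiagonal.2 hp
  · intro p _
    exact p.swap_swap

/-- The coefficients of odd degree of a polynomial. -/
noncomputable def oddCoeff : K[X] →ₗ[K] ℕ →₀ K :=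
  Finsupp.lcomapDomain (fun k => 2 * k + 1) (fun a b h => by simpa using h) ∘ₗ
    (AddMonoidAlgebra.coeffLinearEquiv K).toLinearMap ∘ₗ
      (toFinsuppIsoLinear K).toLinearMap

theorem oddCoeff_apply (p : K[X]) (k : ℕ) : oddCoeff p k = p.coeff (2 * k + 1) := rfl

end Polynomial

/-! ### The two cases and their combination -/

namespace EnvelopingSemidirect

variable {K L : Type*} [Field K] [LieRing L] [LieAlgebra K L]

theorem not_isFinPresented_of_lie_lie_ne_zero {x y : L} (hxy : ∃ v : L, ⁅⁅x, y⁆, v⁆ ≠ 0) :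
    ¬ LieAlgebra.IsFinPresented K (EnvelopingSemidirect K L) := by
  intro h
  -- `x` is not central either, since `⁅x, y⁆ ≠ 0`; one `v` serves both.
  obtain ⟨v, hxv, hv⟩ : ∃ v : L, ⁅x, v⁆ ≠ 0 ∧ ⁅⁅x, y⁆, v⁆ ≠ 0 := by
    refine exists_lie_ne_zero_and_lie_ne_zero ?_ hxy
    by_contra! hx
    obtain ⟨v, hv⟩ := hxy
    simp [hx] at hv
  let b := Module.Basis.ofVectorSpace K L
  let A := MvPolynomial (Module.Basis.ofVectorSpaceIndex K L) K
  let D := adjointDerivation b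
  let ℓ := linearForm b v
  have hD : ∀ z : L, ⁅z, v⁆ ≠ 0 → D z ℓ ≠ 0 := fun z hz => by
    rw [adjointDerivation_linearForm]
    exact fun h0 => hz (linearForm_injective b (h0.trans (map_zero _).symm))
  let φ := UniversalEnvelopingAlgebra.lift K (twistedDerivation D ℓ)
  let p₀ : ℕ →₀ A := Finsupp.single 0 1
  let ev : UniversalEnvelopingAlgebra K L →ₗ[K] ℕ →₀ A :=
    (LinearMap.applyₗ p₀ : Module.End K (ℕ →₀ A) →ₗ[K] _) ∘ₗ φ.toLinearMap
  obtain ⟨t, ht⟩ := exists_finset_mem_span_of_isFinPresented h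
    ((UniversalEnvelopingAlgebra.antipodeForm K L).compr₂ ev)
    (fun u => by
      rw [LinearMap.compr₂_apply, UniversalEnvelopingAlgebra.antipodeForm_self, map_zero])
    (fun z u w => by
      rw [LinearMap.compr₂_apply, LinearMap.compr₂_apply, ← map_add,
        UniversalEnvelopingAlgebra.antipodeForm_ι_mul, map_zero])
  obtain ⟨N, hN⟩ := Finsupp.exists_forall_mem_span_eq_zero (K := K) t
  have hmem := ht 1 (UniversalEnvelopingAlgebra.ι K x ^ N * UniversalEnvelopingAlgebra.ι K y *
    UniversalEnvelopingAlgebra.ι K x ^ (N + 1))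
  rw [LinearMap.compr₂_apply, UniversalEnvelopingAlgebra.antipodeForm_one_mul] at hmem
  have hp₀ : Finsupp.IsTopCoeff 0 1 p₀ :=
    ⟨Finsupp.single_eq_same, fun n hn => Finsupp.single_eq_of_ne hn.ne'⟩
  have htop := (((hp₀.lift_twistedDerivation_pow D ℓ x N).lift_twistedDerivation D ℓ
    ⁅x, y⁆).lift_twistedDerivation_pow D ℓ x N).neg
  -- The value has degree `2N + 1` in `T`, beyond the bound `N`; its top coefficient is a product of
  -- nonzero elements of a domain.
  have hz := hN _ hmem (0 + N + 1 + N) (by omega)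
  have hev : ev (-(UniversalEnvelopingAlgebra.ι K x ^ N * UniversalEnvelopingAlgebra.ι K ⁅x, y⁆ *
      UniversalEnvelopingAlgebra.ι K x ^ N)) =
      -(φ (UniversalEnvelopingAlgebra.ι K x ^ N) (φ (UniversalEnvelopingAlgebra.ι K ⁅x, y⁆)
        (φ (UniversalEnvelopingAlgebra.ι K x ^ N) p₀))) := by
    simp [ev]
  rw [hev, htop.1, neg_eq_zero, mul_one] at hz
  exact mul_ne_zero (pow_ne_zero _ (hD x hxv))
    (mul_ne_zero (hD _ hv) (pow_ne_zero _ (hD x hxv))) hz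

open Polynomial in
theorem not_isFinPresented_of_functional (f : L →ₗ[K] K) (hf : f ≠ 0)
    (hlie : ∀ x y : L, f ⁅x, y⁆ = 0) :
    ¬ LieAlgebra.IsFinPresented K (EnvelopingSemidirect K L) := by
  intro h
  obtain ⟨x, hx⟩ : ∃ x, f x ≠ 0 := by
    by_contra! h0
    exact hf (LinearMap.ext h0)
  let g : L →ₗ⁅K⁆ K[X] :=
    { toFun := fun x => f x • (X : K[X])
      map_add' := fun x y => by rw [map_add, add_smul]
      map_smul' := fun t x => by rw [map_smul, smul_assoc, RingHom.id_apply]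
      map_lie' := fun {x y} => by
        rw [hlie, zero_smul, LieRing.of_associative_ring_bracket, mul_comm, sub_self] }
  let φ := UniversalEnvelopingAlgebra.lift K g
  have hφ : ∀ x, φ (UniversalEnvelopingAlgebra.ι K x) = f x • (X : K[X]) :=
    fun x => UniversalEnvelopingAlgebra.lift_ι_apply K g x
  let B : UniversalEnvelopingAlgebra K L →ₗ[K] UniversalEnvelopingAlgebra K L →ₗ[K] ℕ →₀ K :=
    ((LinearMap.mul K K[X]).compl₁₂ ((aeval (R := K) (C (-1) * X : K[X])).toLinearMap ∘ₗ φ.toLinearMap)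
      φ.toLinearMap).compr₂ oddCoeff
  have hB : ∀ u v, B u v = oddCoeff (aeval (C (-1) * X) (φ u) * φ v) := fun u v => rfl
  obtain ⟨t, ht⟩ := exists_finset_mem_span_of_isFinPresented h B
    (fun u => by
      refine Finsupp.ext fun k => ?_
      rw [hB, oddCoeff_apply]
      exact coeff_aeval_neg_X_mul_self_of_odd _ ⟨k, rfl⟩)
    (fun z u w => by
      rw [hB, hB, ← map_add, map_mul, map_mul, map_mul, hφ, map_smul, aeval_X, C_neg, C_1]
      refine (congrArg oddCoeff ?_).trans (map_zero oddCoeff)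
      rw [smul_mul_assoc, smul_mul_assoc, smul_mul_assoc, mul_smul_comm, ← smul_add]
      convert smul_zero _
      ring)
  obtain ⟨N, hN⟩ := Finsupp.exists_forall_mem_span_eq_zero (K := K) t
  -- Index `N` of `oddCoeff` is degree `2N + 1`, where the value is `f x ^ (2N + 1)`.
  have hz := hN _ (ht 1 (UniversalEnvelopingAlgebra.ι K x ^ (2 * N + 1))) N le_rfl
  rw [hB, map_one, map_one, map_pow, hφ, one_mul, oddCoeff_apply, _root_.smul_pow, coeff_smul,
    coeff_X_pow_self, smul_eq_mul, mul_one] at hz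
  exact pow_ne_zero _ hx hz

/-- If the brackets do not span `L`, a functional kills them. If they span and are all central, `L`
is abelian, so their span is zero, against `L ≠ 0`. -/
theorem not_isFinPresented [Nontrivial L] :
    ¬ LieAlgebra.IsFinPresented K (EnvelopingSemidirect K L) := by
  let M : Submodule K L := Submodule.span K {z | ∃ x y : L, ⁅x, y⁆ = z}
  by_cases hM : M = ⊤
  · by_contra h
    have hcentral : ∀ x y v : L, ⁅⁅x, y⁆, v⁆ = 0 := by
      intro x y v
      by_contra hv
      exact not_isFinPresented_of_lie_lie_ne_zero ⟨v, hv⟩ h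
    have hab : ∀ z v : L, ⁅z, v⁆ = 0 := by
      intro z v
      have hz : z ∈ M := hM ▸ Submodule.mem_top
      induction hz using Submodule.span_induction with
      | mem z hz => obtain ⟨x, y, rfl⟩ := hz; exact hcentral x y v
      | zero => exact zero_lie v
      | add z w _ _ hz hw => rw [add_lie, hz, hw, add_zero]
      | smul t z _ hz => rw [smul_lie, hz, smul_zero]
    have hbot : M = ⊥ := by
      refine Submodule.span_eq_bot.2 ?_
      rintro _ ⟨x, y, rfl⟩
      exact hab x y
    exact bot_ne_top (hbot.symm.trans hM)
  · obtain ⟨f, hf, hfM⟩ := Submodule.exists_le_ker_of_lt_top M (lt_top_iff_ne_top.2 hM)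
    exact not_isFinPresented_of_functional f hf fun x y =>
      hfM (Submodule.subset_span ⟨x, y, rfl⟩)

end EnvelopingSemidirect

theorem lemma3p2 (K L : Type*) [Field K] [LieRing L] [LieAlgebra K L] [FiniteDimensional K L]
    (h : (ringChar K ≠ 2 ∧ Nontrivial L) ∨ (ringChar K = 2 ∧ ¬ IsLieAbelian L)) :
    LieAlgebra.IsFinGenerated K (EnvelopingSemidirect K L) ∧
      ¬ LieAlgebra.IsFinPresented K (EnvelopingSemidirect K L) := by
  have : Nontrivial L := by
    rcases h with h | h
    · exact h.2
    · by_contra hL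
      rw [not_nontrivial_iff_subsingleton] at hL
      exact h.2 inferInstance
  exact ⟨EnvelopingSemidirect.isFinGenerated, EnvelopingSemidirect.not_isFinPresented⟩
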